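/- Let $A$ be a simple Artinian ring and let $R\subseteq A$ be a Dubrovin valuation ring of $A$, i.e. a subring having a two-sided ideal $M$ such that $R/M$ is simple Artinian and for every $q\in A\setminus R$ there are $r,s\in R$ with $rq\in R\setminus M$ and $qs\in R\setminus M$. Assume that $R$ is (left and right) Noetherian, and let $P=J(R)$ be its Jacobson radical. Let $\mathcal{F}(R)$ be the set of fractional $R$-ideals of $A$, i.e. of $R$-subbimodules $I\subseteq A$ that contain a regular element of $R$ and satisfy $rI\subseteq R$ for some regular element $r$ of $R$. For $I\in\mathcal{F}(R)$ put $$v(I)=(P:I)=\{a\in A\mid aI\subseteq P\},\qquad \Gamma=\{v(I)\mid I\in\mathcal{F}(R)\},$$ where $\Gamma$ is ordered by inclusion. Then there is a (not a priori commutative) group operation $+$ on $\Gamma$, with neutral element $0$, which makes $\Gamma$ a totally ordered group (the order is total and invariant under left and right translations) and for which $v:\mathcal{F}(R)\to\Gamma$ is an arithmetical pseudo-valuation: for all $I,J\in\mathcal{F}(R)$, 1. $v(IJ)=v(I)+v(J)$; 2. $v(I+J)\geq\min\{v(I),v(J)\}$; 3. $v(R)=0$; 4. $I\subseteq J$ implies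 $v(I)\geq v(J)$. Furthermore $RaR\in\mathcal{F}(R)$ for every nonzero $a\in A$, and $$P=\{0\}\cup\{a\in A\setminus\{0\}\mid v(RaR)>0\},\qquad R=\{0\}\cup\{a\in A\setminus\{0\}\mid v(RaR)\geq 0\}.$$ -/

import Mathlib

namespace Dubrovin

variable {A : Type*} [Ring A]

/-- `R` is a Dubrovin valuation ring of `A`: it has a two-sided ideal `M` such that `R / M` is
simple Artinian and every `q ∈ A \ R` has multiples `r q` and `q s`, with `r, s ∈ R`, that lie in
`R \ M`. -/
def IsDubrovinValuationRing (R : Subring A) : Prop :=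
  ∃ (M : Ideal R) (_ : M.IsTwoSided),
    IsSimpleRing (R ⧸ M) ∧ IsArtinianRing (R ⧸ M) ∧
    ∀ q : A, q ∉ R →
      (∃ r ∈ R, ∃ h : r * q ∈ R, (⟨r * q, h⟩ : R) ∉ M) ∧
      (∃ s ∈ R, ∃ h : q * s ∈ R, (⟨q * s, h⟩ : R) ∉ M)

/-- Left and right Noetherian. -/
def IsTwoSidedNoetherian (R : Subring A) : Prop :=
  IsNoetherianRing R ∧ IsNoetherianRing (R)ᵐᵒᵖ

/-- `R` as an additive subgroup of `A`. Additive subgroups are written as `ℤ`-submodules, for which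
`I * J` is the additive subgroup generated by the products and `I ⊔ J` is the sum. -/
def ringPart (R : Subring A) : Submodule ℤ A := AddSubgroup.toIntSubmodule R.toAddSubgroup

/-- The Jacobson radical `P = J(R)` as an additive subgroup of `A`. -/
def radPart (R : Subring A) : Submodule ℤ A :=
  AddSubgroup.toIntSubmodule
    ((Ring.jacobson R).toAddSubgroup.map (R.subtype : R →+ A))

/-- The `R`-bimodule `R a R`. -/
def principal (R : Subring A) (a : A) : Submodule ℤ A :=
  Submodule.span ℤ {x | ∃ r ∈ R, ∃ s ∈ R, x = r * a * s}

/-- A fractional `R`-ideal of `A`: an `R`-bimodule `I ⊆ A` that contains a regular element of `R`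
and satisfies `r I ⊆ R` for some regular element `r` of `R`. -/
structure IsFracIdeal (R : Subring A) (I : Submodule ℤ A) : Prop where
  left_mul_mem : ∀ r ∈ R, ∀ x ∈ I, r * x ∈ I
  mul_right_mem : ∀ r ∈ R, ∀ x ∈ I, x * r ∈ I
  exists_regular : ∃ u : R, IsRegular u ∧ (u : A) ∈ I
  exists_denom : ∃ r : R, IsRegular r ∧ ∀ x ∈ I, (r : A) * x ∈ R

/-- The set `𝓕(R)` of fractional `R`-ideals, ordered by inclusion. -/
abbrev FracIdeal (R : Subring A) := {I : Submodule ℤ A // IsFracIdeal R I}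

theorem isFracIdeal_ringPart (R : Subring A) : IsFracIdeal R (ringPart R) where
  left_mul_mem := fun _ hr _ hx => R.mul_mem hr hx
  mul_right_mem := fun _ hr _ hx => R.mul_mem hx hr
  exists_regular := ⟨1, isRegular_one, R.one_mem⟩
  exists_denom := ⟨1, isRegular_one, fun x hx => by rw [R.coe_one, one_mul]; exact hx⟩

theorem IsFracIdeal.mul {R : Subring A} {I J : Submodule ℤ A}
    (hI : IsFracIdeal R I) (hJ : IsFracIdeal R J) : IsFracIdeal R (I * J) where
  left_mul_mem := fun r hr x hx => by
    induction hx using Submodule.mul_induction_on' with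
    | mem_mul_mem m hm n hn =>
      rw [← mul_assoc]
      exact Submodule.mul_mem_mul (hI.left_mul_mem r hr m hm) hn
    | add x _ y _ h1 h2 => rw [mul_add]; exact Submodule.add_mem _ h1 h2
  mul_right_mem := fun r hr x hx => by
    induction hx using Submodule.mul_induction_on' with
    | mem_mul_mem m hm n hn =>
      rw [mul_assoc]
      exact Submodule.mul_mem_mul hm (hJ.mul_right_mem r hr n hn)
    | add x _ y _ h1 h2 => rw [add_mul]; exact Submodule.add_mem _ h1 h2
  exists_regular := by
    obtain ⟨u, hu, huI⟩ := hI.exists_regular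
    obtain ⟨w, hw, hwJ⟩ := hJ.exists_regular
    exact ⟨u * w, hu.mul hw, Submodule.mul_mem_mul huI hwJ⟩
  exists_denom := by
    obtain ⟨r, hr, hrI⟩ := hI.exists_denom
    obtain ⟨s, hs, hsJ⟩ := hJ.exists_denom
    refine ⟨s * r, hs.mul hr, fun x hx => ?_⟩
    induction hx using Submodule.mul_induction_on' with
    | mem_mul_mem m hm n hn =>
      have h := hsJ _ (hJ.left_mul_mem _ (hrI m hm) n hn)
      simpa [mul_assoc] using h
    | add x _ y _ h1 h2 => rw [mul_add]; exact R.add_mem h1 h2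

theorem IsFracIdeal.sup {R : Subring A} {I J : Submodule ℤ A}
    (hI : IsFracIdeal R I) (hJ : IsFracIdeal R J) : IsFracIdeal R (I ⊔ J) where
  left_mul_mem := fun r hr x hx => by
    obtain ⟨y, hy, z, hz, rfl⟩ := Submodule.mem_sup.1 hx
    rw [mul_add]
    exact Submodule.add_mem_sup (hI.left_mul_mem r hr y hy) (hJ.left_mul_mem r hr z hz)
  mul_right_mem := fun r hr x hx => by
    obtain ⟨y, hy, z, hz, rfl⟩ := Submodule.mem_sup.1 hx
    rw [add_mul]
    exact Submodule.add_mem_sup (hI.mul_right_mem r hr y hy) (hJ.mul_right_mem r hr z hz)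
  exists_regular := by
    obtain ⟨u, hu, huI⟩ := hI.exists_regular
    exact ⟨u, hu, Submodule.mem_sup_left huI⟩
  exists_denom := by
    obtain ⟨r, hr, hrI⟩ := hI.exists_denom
    obtain ⟨s, hs, hsJ⟩ := hJ.exists_denom
    refine ⟨s * r, hs.mul hr, fun x hx => ?_⟩
    obtain ⟨y, hy, z, hz, rfl⟩ := Submodule.mem_sup.1 hx
    rw [mul_add]
    refine R.add_mem ?_ ?_
    · simpa [mul_assoc] using R.mul_mem s.2 (hrI y hy)
    · simpa [mul_assoc] using hsJ _ (hJ.left_mul_mem _ r.2 z hz)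

instance (R : Subring A) : One (FracIdeal R) := ⟨⟨ringPart R, isFracIdeal_ringPart R⟩⟩

instance (R : Subring A) : Mul (FracIdeal R) := ⟨fun I J => ⟨I.1 * J.1, I.2.mul J.2⟩⟩

instance (R : Subring A) : Add (FracIdeal R) := ⟨fun I J => ⟨I.1 ⊔ J.1, I.2.sup J.2⟩⟩

/-- An arithmetical pseudo-valuation on `𝓕(R)` with values in a partially ordered semigroup with
zero. The inequality `v (I + J) ≥ min (v I) (v J)` says that every common lower bound of `v I` and
`v J` is a lower bound of `v (I + J)`; for a total order this is the usual inequality. -/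
structure IsArithmeticalPseudoValuation (R : Subring A) {Γ : Type*} [AddMonoid Γ] [PartialOrder Γ]
    [AddLeftMono Γ] [AddRightMono Γ] (v : FracIdeal R → Γ) : Prop where
  map_mul : ∀ I J, v (I * J) = v I + v J
  le_map_add : ∀ I J γ, γ ≤ v I → γ ≤ v J → γ ≤ v (I + J)
  map_one : v 1 = 0
  anti : ∀ I J, I ≤ J → v J ≤ v I

/-- `(P : I) = {a ∈ A | a I ⊆ P}` with `P = J(R)`. -/
def colon (R : Subring A) (I : Submodule ℤ A) : Submodule ℤ A where
  carrier := {a | ∀ x ∈ I, a * x ∈ radPart R}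
  zero_mem' := fun x _ => by rw [zero_mul]; exact Submodule.zero_mem _
  add_mem' := fun ha hb x hx => by
    rw [add_mul]; exact Submodule.add_mem _ (ha x hx) (hb x hx)
  smul_mem' := fun n a ha x hx => by
    rw [smul_mul_assoc]; exact Submodule.smul_mem _ n (ha x hx)

/-- `Γ = {(P : I) | I ∈ 𝓕(R)}`, ordered by inclusion. -/
abbrev ValueSet (R : Subring A) := {S : Submodule ℤ A // ∃ I : FracIdeal R, colon R I.1 = S}

/-- The map `I ↦ (P : I)` from `𝓕(R)` to `Γ`. -/
def val (R : Subring A) (I : FracIdeal R) : ValueSet R := ⟨colon R I.1, I, rfl⟩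

end Dubrovin

/-! A noncommutative form of the fact that a Noetherian valuation ring is a field or discrete. Since
`R / M` is simple and elements outside `R` have multiples in `R \ M`, the ideal `M` is the Jacobson
radical, and every `R`-subbimodule of `A` contains `1` or lies in `M` (`one_mem_or_le`).

If `M = 0`, then `R = A` and `Γ` is a point. If `M ≠ 0`, finite generation makes `M / M²` a finite
module over the simple Artinian ring `R / M`. Too many generators would give an injective linear map
from `A ^ l` to `A ^ n` with `n < l`; so `M / M²` is cyclic, Nakayama gives `M = R p`, and `p` is a
unit of `A` with `R p = p R` (`exists_unit_generator`).

Translating the dichotomy by powers of `p`, a bimodule contains `p ^ k` or lies in `p ^ (k + 1) R`.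
As `⋂ p ^ k R = 0` (Nakayama) and `⋃ p ^ (-k) R = A` (`unionPow_eq_top`), every fractional ideal and
every nonzero `R a R` is some `p ^ k R`. Finally `(P : p ^ k R) = p ^ (1 - k) R` grows with `k`, so
`Γ` is a copy of `ℤ` with `v (p ^ k R) = k`. -/

namespace Dubrovin

/-! ### The ideal `M`: radical, right order, bimodule dichotomy -/

section

variable {A : Type*} [Ring A] {R : Subring A}

/-- The image in `A` of a left ideal of the subring `R`. -/
def idealPart (I : Ideal R) : Submodule ℤ A :=
  AddSubgroup.toIntSubmodule (I.toAddSubgroup.map (R.subtype : R →+ A))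

theorem mem_idealPart {I : Ideal R} {a : A} :
    a ∈ idealPart I ↔ ∃ h : a ∈ R, (⟨a, h⟩ : R) ∈ I := by
  constructor
  · rintro ⟨x, hx, rfl⟩
    exact ⟨x.2, hx⟩
  · rintro ⟨h, hI⟩
    exact ⟨⟨a, h⟩, hI, rfl⟩

theorem coe_mem_idealPart {I : Ideal R} {r : R} : (r : A) ∈ idealPart I ↔ r ∈ I := by
  rw [mem_idealPart]
  exact ⟨fun ⟨_, h⟩ => h, fun h => ⟨r.2, h⟩⟩

theorem idealPart_subset {I : Ideal R} {a : A} (h : a ∈ idealPart I) : a ∈ R :=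
  (mem_idealPart.1 h).1

theorem mul_mem_idealPart {I : Ideal R} {r a : A} (hr : r ∈ R) (h : a ∈ idealPart I) :
    r * a ∈ idealPart I := by
  obtain ⟨ha, hI⟩ := mem_idealPart.1 h
  exact mem_idealPart.2 ⟨R.mul_mem hr ha, I.mul_mem_left ⟨r, hr⟩ hI⟩

theorem idealPart_mul_mem {I : Ideal R} [I.IsTwoSided] {r a : A} (hr : r ∈ R)
    (h : a ∈ idealPart I) : a * r ∈ idealPart I := by
  obtain ⟨ha, hI⟩ := mem_idealPart.1 h
  exact mem_idealPart.2 ⟨R.mul_mem ha hr, I.mul_mem_right ⟨r, hr⟩ hI⟩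

theorem one_notMem_idealPart {I : Ideal R} (hI : I ≠ ⊤) : (1 : A) ∉ idealPart I := fun h =>
  hI ((Ideal.eq_top_iff_one I).2 (coe_mem_idealPart.1 (by simpa using h)))

/-- An additive subgroup of `A` stable under multiplication by `R` on both sides. -/
structure IsBimodule (R : Subring A) (C : Submodule ℤ A) : Prop where
  left_mul_mem : ∀ r ∈ R, ∀ x ∈ C, r * x ∈ C
  mul_right_mem : ∀ r ∈ R, ∀ x ∈ C, x * r ∈ C

/-- Every `q ∉ R` has multiples `r q` and `q s` in `R \ M` with `r, s ∈ R`. -/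
structure HasMultiples (R : Subring A) (M : Ideal R) : Prop where
  left : ∀ q : A, q ∉ R → ∃ r ∈ R, r * q ∈ R ∧ r * q ∉ idealPart M
  right : ∀ q : A, q ∉ R → ∃ s ∈ R, q * s ∈ R ∧ q * s ∉ idealPart M

theorem exists_mul_mul_ne_zero [IsSimpleRing A] {e f : A} (he : e ≠ 0) (hf : f ≠ 0) :
    ∃ y, e * y * f ≠ 0 := by
  by_contra! h
  let D : TwoSidedIdeal A := TwoSidedIdeal.mk' {x | ∀ a, x * a * f = 0} (by simp)
    (fun hx hy a => by rw [add_mul, add_mul, hx a, hy a, add_zero])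
    (fun hx a => by rw [neg_mul, neg_mul, hx a, neg_zero])
    (fun {x y} hy a => by rw [mul_assoc x, mul_assoc x, hy a, mul_zero])
    (fun {x y} hx a => by rw [mul_assoc x]; exact hx _)
  have hD : ∀ x, x ∈ D ↔ ∀ a, x * a * f = 0 := fun x => by
    rw [TwoSidedIdeal.mem_mk']; rfl
  rcases eq_bot_or_eq_top D with h0 | h1
  · exact he (by simpa [h0] using (hD e).2 h)
  · exact hf (by simpa using (hD 1).1 (h1 ▸ TwoSidedIdeal.mem_top _) 1)

/-- If every left ideal `X ⊇ M` of `R` has a weak complement modulo `M`, then the right order of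
`M` is `R`. -/
theorem mem_of_idealPart_mul_le {M : Ideal R}
    (h : ∀ q : A, q ∉ R → ∃ r ∈ R, r * q ∈ R ∧ r * q ∉ idealPart M)
    (hc : ∀ X : Ideal R, M ≤ X → X ≠ ⊤ → ∃ f : R, f ∉ X ∧ ∀ r : R, r * f ∈ X → r * f ∈ M)
    {q : A} (hq : ∀ m ∈ idealPart M, m * q ∈ idealPart M) : q ∈ R := by
  let X : Ideal R :=
    { carrier := {r | (r : A) * q ∈ R}
      zero_mem' := by simp [R.zero_mem]
      add_mem' := fun {a b} ha hb => by
        simp only [Set.mem_ofPred_eq, R.coe_add, add_mul] at *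
        exact R.add_mem ha hb
      smul_mem' := fun c x hx => by
        simp only [Set.mem_ofPred_eq, smul_eq_mul, R.coe_mul, mul_assoc] at *
        exact R.mul_mem c.2 hx }
  have hX : ∀ r : R, r ∈ X ↔ (r : A) * q ∈ R := fun _ => Iff.rfl
  by_contra hqR
  obtain ⟨f, hf, hf'⟩ := hc X
    (fun m hm => idealPart_subset (hq m (coe_mem_idealPart.2 hm)))
    (fun ht => hqR (by simpa using (hX 1).1 (ht ▸ Submodule.mem_top)))
  -- As `f q ∉ R`, some `r f q` lies in `R \ M`; then `r f ∈ X`, so `r f ∈ M`, and `M q ⊆ M` forces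
  -- `r f q ∈ M`.
  obtain ⟨r, hr, hrq, hn⟩ := h _ (fun hfq => hf ((hX f).2 hfq))
  rw [← mul_assoc] at hrq hn
  exact hn (hq _ (coe_mem_idealPart.2 (hf' ⟨r, hr⟩ hrq)))

variable {M : Ideal R} [M.IsTwoSided]

/-- `M` contains no nonzero left ideal of `A`. The largest one, `K`, is `A e` with `e` idempotent. A
nonzero `q ∈ e A (1 - e)` cannot lie in `R`, since then `q ∈ K` and `q = q e = 0`; nor outside,
since `q s = e (q s) ∈ M` whenever `q s ∈ R`. -/
theorem eq_zero_of_forall_mul_mem [IsSimpleRing A] [IsArtinianRing A] (hM : M ≠ ⊤)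
    (h : HasMultiples R M) {x : A} (hx : ∀ a, a * x ∈ idealPart M) : x = 0 := by
  let K : Ideal A :=
    { carrier := {x | ∀ a, a * x ∈ idealPart M}
      zero_mem' := fun a => by simp
      add_mem' := fun hx hy a => by rw [mul_add]; exact add_mem (hx a) (hy a)
      smul_mem' := fun c x hx a => by rw [smul_eq_mul, ← mul_assoc]; exact hx _ }
  have hK : ∀ y, y ∈ K ↔ ∀ a, a * y ∈ idealPart M := fun _ => Iff.rfl
  have hKP : ∀ y ∈ K, y ∈ idealPart M := fun y hy => by simpa using hy 1
  obtain ⟨e, he, hKe⟩ := IsSemisimpleRing.ideal_eq_span_idempotent K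
  have heK : e ∈ K := hKe ▸ Ideal.mem_span_singleton_self e
  have hmul : ∀ y ∈ K, y * e = y := fun y hy => by
    rw [hKe, Ideal.mem_span_singleton'] at hy
    obtain ⟨a, rfl⟩ := hy
    rw [mul_assoc, he.eq]
  suffices e = 0 by
    have := hmul x hx
    rw [← this, ‹e = 0›, mul_zero]
  by_contra he0
  have hf : (1 - e) ≠ 0 := fun hf => one_notMem_idealPart hM
    ((sub_eq_zero.1 hf).symm ▸ hKP e heK)
  obtain ⟨y, hy⟩ := exists_mul_mul_ne_zero he0 hf
  set q := e * y * (1 - e) with hq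
  have heq : e * q = q := by rw [hq, ← mul_assoc, ← mul_assoc, he.eq]
  have hqe : q * e = 0 := by rw [hq, mul_assoc, sub_mul, one_mul, he.eq, sub_self, mul_zero]
  by_cases hqR : q ∈ R
  · have : q ∈ K := fun a => by
      rw [← heq, ← mul_assoc]
      exact idealPart_mul_mem hqR (heK a)
    exact hy (by rw [← hmul q this, hqe])
  · obtain ⟨s, hs, hqs, hn⟩ := h.right q hqR
    apply hn
    rw [← heq, mul_assoc]
    exact idealPart_mul_mem hqs (hKP e heK)

/-- If `q = q m`, then `q ∈ M`, as otherwise a multiple `r q = (r q) m` would be in `R \ M`. Such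
`q` form a left ideal of `A`, hence vanish, and `1 - m` is a unit of the Artinian ring `A`. The same
trick applied to `w = 1 + w m` puts the inverse in `R`. -/
theorem exists_inv_one_sub [IsSimpleRing A] [IsArtinianRing A] (hM : M ≠ ⊤)
    (h : HasMultiples R M) {m : A} (hm : m ∈ idealPart M) :
    ∃ u ∈ R, u * (1 - m) = 1 ∧ (1 - m) * u = 1 := by
  have hP : ∀ q : A, q = q * m → q ∈ idealPart M := fun q hq => by
    by_cases hqR : q ∈ R
    · rw [hq]; exact mul_mem_idealPart hqR hm
    · obtain ⟨r, hr, hrq, hn⟩ := h.left q hqR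
      refine absurd ?_ hn
      rw [hq, ← mul_assoc]
      exact mul_mem_idealPart hrq hm
  have hz : ∀ q : A, q * (1 - m) = 0 → q = 0 := fun q hq => by
    rw [mul_sub, mul_one, sub_eq_zero] at hq
    refine eq_zero_of_forall_mul_mem hM h fun a => hP _ ?_
    rw [mul_assoc, ← hq]
  have hu : IsUnit (1 - m) := IsArtinianRing.isUnit_iff_isRightRegular.2
    fun x y hxy => sub_eq_zero.1 (hz _ (by rw [sub_mul]; exact sub_eq_zero.2 hxy))
  obtain ⟨u, hu⟩ := hu
  have h1 : (↑u⁻¹ : A) * (1 - m) = 1 := by rw [← hu]; simp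
  have h2 : (1 - m) * (↑u⁻¹ : A) = 1 := by rw [← hu]; simp
  refine ⟨↑u⁻¹, ?_, h1, h2⟩
  set w : A := ↑u⁻¹
  have hwm : w = 1 + w * m := by
    rw [mul_sub, mul_one] at h1; rw [← h1]; abel
  by_contra hw
  have hw' : w * m ∉ R := fun hc => hw (hwm ▸ R.add_mem R.one_mem hc)
  obtain ⟨r, hr, hrw, hn⟩ := h.left _ hw'
  have : r * w ∈ R := by
    rw [hwm, mul_add, mul_one]; exact R.add_mem hr hrw
  apply hn
  rw [← mul_assoc]
  exact mul_mem_idealPart this hm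

theorem eq_jacobson [IsSimpleRing A] [IsArtinianRing A] [IsSimpleRing (R ⧸ M)]
    [IsArtinianRing (R ⧸ M)] (hM : M ≠ ⊤) (h : HasMultiples R M) : M = Ring.jacobson R := by
  apply le_antisymm
  · rw [Ring.jacobson_eq_sInf_isMaximal]
    refine le_sInf fun m hm => ?_
    by_contra hc
    have hm' : m.IsMaximal := hm
    have := hm'.out.2 (m ⊔ M) (lt_of_le_of_ne le_sup_left fun h => hc (h ▸ le_sup_right))
    obtain ⟨x, hx, y, hy, hxy⟩ := Submodule.mem_sup.1 ((Ideal.eq_top_iff_one _).1 this)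
    obtain ⟨u, hu, hu1, -⟩ := exists_inv_one_sub hM h (coe_mem_idealPart.2 hy)
    refine hm'.ne_top ((Ideal.eq_top_iff_one _).2 ?_)
    have : (1 : R) = ⟨u, hu⟩ * x := by
      rw [← eq_sub_iff_add_eq] at hxy
      apply Subtype.ext
      rw [hxy]
      simpa using hu1.symm
    rw [this]
    exact m.mul_mem_left _ hx
  · exact Ring.jacobson_le_of_eq_bot (IsSemisimpleModule.jacobson_eq_bot _ _)

/-- An `R`-bimodule that is not contained in `M` contains `1`. -/
theorem one_mem_or_le [IsSimpleRing A] [IsArtinianRing A] [IsSimpleRing (R ⧸ M)] (hM : M ≠ ⊤)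
    (h : HasMultiples R M) {C : Submodule ℤ A} (hC : IsBimodule R C) :
    1 ∈ C ∨ C ≤ idealPart M := by
  by_cases hx : ∃ x : R, (x : A) ∈ C ∧ x ∉ M
  · left
    obtain ⟨x, hxC, hxM⟩ := hx
    -- The image of `C ∩ R` in the simple ring `R / M`; if it is everything, `C` contains some `c ∈
    -- 1 + M`, a unit of `R`.
    let D : TwoSidedIdeal (R ⧸ M) := TwoSidedIdeal.mk'
      {y | ∃ c : R, (c : A) ∈ C ∧ Ideal.Quotient.mk M c = y} ⟨0, by simp, by simp⟩
      (by rintro _ _ ⟨c, hc, rfl⟩ ⟨d, hd, rfl⟩; exact ⟨c + d, by simpa using add_mem hc hd, by simp⟩)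
      (by rintro _ ⟨c, hc, rfl⟩; exact ⟨-c, by simpa using hc, by simp⟩)
      (by
        rintro y _ ⟨c, hc, rfl⟩
        obtain ⟨d, rfl⟩ := Ideal.Quotient.mk_surjective y
        exact ⟨d * c, hC.left_mul_mem d d.2 c hc, by simp⟩)
      (by
        rintro _ y ⟨c, hc, rfl⟩
        obtain ⟨d, rfl⟩ := Ideal.Quotient.mk_surjective y
        exact ⟨c * d, hC.mul_right_mem d d.2 c hc, by simp⟩)
    have hD : ∀ y, y ∈ D ↔ ∃ c : R, (c : A) ∈ C ∧ Ideal.Quotient.mk M c = y := fun y => by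
      rw [TwoSidedIdeal.mem_mk']; rfl
    rcases eq_bot_or_eq_top D with h0 | h1
    · refine absurd ?_ hxM
      have : Ideal.Quotient.mk M x ∈ D := (hD _).2 ⟨x, hxC, rfl⟩
      rw [h0, TwoSidedIdeal.mem_bot] at this
      exact Ideal.Quotient.eq_zero_iff_mem.1 this
    · obtain ⟨c, hc, hc1⟩ := (hD 1).1 (h1 ▸ TwoSidedIdeal.mem_top _)
      rw [← map_one (Ideal.Quotient.mk M), eq_comm, Ideal.Quotient.eq] at hc1
      obtain ⟨u, hu, hu1, -⟩ := exists_inv_one_sub hM h (coe_mem_idealPart.2 hc1)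
      have : u * (1 - ((1 - c : R) : A)) ∈ C := by
        simpa using hC.left_mul_mem u hu c hc
      rwa [hu1] at this
  · right
    push Not at hx
    intro q hq
    by_cases hqR : q ∈ R
    · exact coe_mem_idealPart.2 (hx ⟨q, hqR⟩ hq)
    · obtain ⟨r, hr, hrq, hn⟩ := h.left q hqR
      exact absurd (coe_mem_idealPart.2 (hx ⟨r * q, hrq⟩ (hC.left_mul_mem r hr q hq))) hn

/-- `f` lifts an element, outside the image of `X`, of a complement of that image in the semisimple
ring `R / M`. -/
theorem exists_weak_compl (M : Ideal R) [M.IsTwoSided] [IsSemisimpleRing (R ⧸ M)] (X : Ideal R)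
    (hX : M ≤ X) (hX' : X ≠ ⊤) : ∃ f : R, f ∉ X ∧ ∀ r : R, r * f ∈ X → r * f ∈ M := by
  obtain ⟨Y, hY⟩ := exists_isCompl (X.map (Ideal.Quotient.mk M))
  have hmem : ∀ x, Ideal.Quotient.mk M x ∈ X.map (Ideal.Quotient.mk M) → x ∈ X := fun x hx => by
    rw [Ideal.mem_map_iff_of_surjective _ Ideal.Quotient.mk_surjective] at hx
    obtain ⟨z, hz, hzx⟩ := hx
    have := X.sub_mem hz (hX (Ideal.Quotient.eq.1 hzx))
    simpa using this
  by_contra! hc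
  apply hX'
  rw [Ideal.eq_top_iff_one]
  obtain ⟨a, ha, b, hb, hab⟩ := Submodule.mem_sup.1
    ((Ideal.eq_top_iff_one _).1 (codisjoint_iff.1 hY.codisjoint))
  obtain ⟨f, rfl⟩ := Ideal.Quotient.mk_surjective b
  have hfX : f ∈ X := by
    by_contra hf
    obtain ⟨r, hr, hrM⟩ := hc f hf
    apply hrM
    rw [← Ideal.Quotient.eq_zero_iff_mem]
    refine Submodule.disjoint_def.1 hY.disjoint _ (Ideal.mem_map_of_mem _ hr) ?_
    rw [map_mul]
    exact Y.mul_mem_left _ hb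
  apply hmem
  rw [map_one, ← hab]
  exact add_mem ha (Ideal.mem_map_of_mem _ hfX)

end
-- Modules over a simple Artinian ring; Nakayama
/-- A finitely generated module over a simple Artinian ring is cyclic, or one of its finite powers
is free of larger rank than the number of factors. -/
theorem exists_generator_or_equiv (S V : Type*) [Ring S] [IsSimpleRing S] [IsArtinianRing S]
    [AddCommGroup V] [Module S V] [Module.Finite S V] :
    (∃ v : V, ∀ w, ∃ s : S, s • v = w) ∨
      ∃ n l : ℕ, n < l ∧ Nonempty ((Fin n → V) ≃ₗ[S] (Fin l → S)) := by
  obtain ⟨n, -, T, hT, ⟨e⟩⟩ := (IsSimpleRing.isIsotypic S S).linearEquiv_fun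
  have hV : IsIsotypicOfType S V T := fun m _ => by
    obtain ⟨I, ⟨f⟩⟩ := IsSemisimpleRing.exists_linearEquiv_ideal_of_isSimpleModule S m
    have := IsSimpleModule.congr f.symm
    exact ⟨f.trans (IsSimpleRing.isIsotypic S S T I).some⟩
  obtain ⟨l, ⟨g⟩⟩ := hV.linearEquiv_fun
  -- With `S ≅ T ^ n` and `V ≅ T ^ l` for one simple `T`: if `l ≤ n`, then `V` is a quotient of `S`;
  -- otherwise `V ^ n ≅ T ^ (l n) ≅ S ^ l`.
  rcases le_or_gt l n with hln | hln
  · left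
    let φ : S →ₗ[S] V := g.symm.toLinearMap ∘ₗ LinearMap.funLeft S T (Fin.castLE hln) ∘ₗ
      e.toLinearMap
    have hφ : Function.Surjective φ := g.symm.surjective.comp
      ((LinearMap.funLeft_surjective_of_injective S T _ (Fin.castLE_injective hln)).comp
        e.surjective)
    refine ⟨φ 1, fun w => ?_⟩
    obtain ⟨s, rfl⟩ := hφ w
    exact ⟨s, by rw [← map_smul, smul_eq_mul, mul_one]⟩
  · right
    let sw : (Fin n → Fin l → T) ≃ₗ[S] (Fin l → Fin n → T) :=
      { Equiv.piComm (fun _ _ => T) with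
        map_add' := fun _ _ => rfl
        map_smul' := fun _ _ => rfl }
    exact ⟨n, l, hln, ⟨(LinearEquiv.piCongrRight fun _ => g).trans
      (sw.trans (LinearEquiv.piCongrRight fun _ => e.symm))⟩⟩

/-- Nakayama's lemma for submodules over a noncommutative ring. -/
theorem le_of_le_sup_jacobson_smul {S V : Type*} [Ring S] [AddCommGroup V] [Module S V]
    {N N' : Submodule S V} (hN' : N'.FG) (h : N' ≤ N ⊔ Ring.jacobson S • N') : N' ≤ N := by
  have h0 : N'.map N.mkQ = ⊥ := by
    refine (hN'.map N.mkQ).eq_bot_of_le_jacobson_smul ?_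
    refine (Submodule.map_mono h).trans ?_
    rw [Submodule.map_sup, Submodule.mkQ_map_self, bot_sup_eq, Submodule.map_smul'']
  intro x hx
  have : N.mkQ x ∈ N'.map N.mkQ := Submodule.mem_map_of_mem hx
  rw [h0, Submodule.mem_bot] at this
  simpa using this

/-! ### `M` is generated by a unit of `A` -/

section

variable {A : Type*} [Ring A] [IsSimpleRing A] [IsArtinianRing A] {R : Subring A}
  {M : Ideal R} [M.IsTwoSided]

/-- Clears denominators to a vector that is nonzero modulo `M`. Multiplying by `r` to repair the
entry `j` moves that entry into `R \ M`, so the nonvanishing survives each step. -/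
theorem exists_mul_vec_mem {ι : Type*} [Fintype ι] (hM : M ≠ ⊤) (h : HasMultiples R M)
    {x : ι → A} (hx : x ≠ 0) :
    ∃ a, (∀ i, a * x i ∈ R) ∧ ∃ i, a * x i ∉ idealPart M := by
  classical
  obtain ⟨i₀, hi₀⟩ := Function.ne_iff.1 hx
  have key : ∀ s : Finset ι, ∃ a, (∀ i ∈ s, a * x i ∈ R) ∧ ∃ i, a * x i ∉ idealPart M := by
    intro s
    induction s using Finset.induction_on with
    | empty =>
      by_contra! hc
      exact hi₀ (eq_zero_of_forall_mul_mem hM h fun a => hc a (by simp) i₀)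
    | insert j s _ ih =>
      obtain ⟨a, ha, hi⟩ := ih
      by_cases hj : a * x j ∈ R
      · exact ⟨a, fun i hi => by
          rcases Finset.mem_insert.1 hi with rfl | hi
          exacts [hj, ha i hi], hi⟩
      · obtain ⟨r, hr, hrj, hn⟩ := h.left _ hj
        rw [← mul_assoc] at hrj hn
        refine ⟨r * a, fun i hi => ?_, j, hn⟩
        rcases Finset.mem_insert.1 hi with rfl | hi
        · exact hrj
        · rw [mul_assoc]; exact R.mul_mem hr (ha i hi)
  obtain ⟨a, ha, hi⟩ := key Finset.univ
  exact ⟨a, fun i => ha i (Finset.mem_univ i), hi⟩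

/-- Write `A M = A e` with `e` idempotent. The right annihilator `T` of `M` is a bimodule without
`1`, so `T ⊆ M`, and `1 - e ∈ T`. If `e ≠ 1`, take `q ≠ 0` in `e A (1 - e)`: `q ∈ R` gives `q ∈ T`
and `q = e q = 0`, while `q ∉ R` has a multiple `r q = (r q) (1 - e)` in `R \ M` that lies in `M`.
-/
theorem span_idealPart_eq_top [IsSimpleRing (R ⧸ M)] [IsArtinianRing (R ⧸ M)] (hM : M ≠ ⊤)
    (hM0 : M ≠ ⊥) (h : HasMultiples R M) : Ideal.span (idealPart M : Set A) = ⊤ := by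
  obtain ⟨e, he, hKe⟩ := IsSemisimpleRing.ideal_eq_span_idempotent
    (Ideal.span (idealPart M : Set A))
  have hme : ∀ m ∈ idealPart M, m * e = m := fun m hm => by
    have : m ∈ Ideal.span (idealPart M : Set A) := Ideal.subset_span hm
    rw [hKe, Ideal.mem_span_singleton'] at this
    obtain ⟨a, rfl⟩ := this
    rw [mul_assoc, he.eq]
  have heK : e ∈ Ideal.span (idealPart M : Set A) := hKe ▸ Ideal.mem_span_singleton_self e
  have hez : ∀ q, (∀ m ∈ idealPart M, m * q = 0) → e * q = 0 := fun q hq => by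
    clear hKe hme he
    induction heK using Submodule.span_induction with
    | mem x hx => exact hq x hx
    | zero => simp
    | add x y _ _ hx hy => rw [add_mul, hx, hy, add_zero]
    | smul a x _ hx => rw [smul_eq_mul, mul_assoc, hx, mul_zero]
  have he0 : e ≠ 0 := by
    rintro rfl
    refine hM0 (le_bot_iff.1 fun m hm => ?_)
    have := hme m (coe_mem_idealPart.2 hm)
    rw [mul_zero] at this
    exact Subtype.ext this.symm
  let T : Submodule ℤ A :=
    { carrier := {q | ∀ m ∈ idealPart M, m * q = 0}
      zero_mem' := fun m _ => mul_zero m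
      add_mem' := fun hx hy m hm => by rw [mul_add, hx m hm, hy m hm, add_zero]
      smul_mem' := fun n x hx m hm => by rw [mul_smul_comm, hx m hm, smul_zero] }
  have hT : IsBimodule R T :=
    { left_mul_mem := fun r hr x hx m hm => by
        rw [← mul_assoc]; exact hx _ (idealPart_mul_mem hr hm)
      mul_right_mem := fun r _ x hx m hm => by rw [← mul_assoc, hx m hm, zero_mul] }
  have hTP : T ≤ idealPart M := by
    refine (one_mem_or_le hM h hT).resolve_left fun h1 => he0 ?_
    simpa using hez 1 h1
  suffices hf : 1 - e = 0 by
    rw [hKe, ← sub_eq_zero.1 hf, Ideal.span_singleton_one]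
  by_contra hf
  have hfT : 1 - e ∈ T := fun m hm => by rw [mul_sub, mul_one, hme m hm, sub_self]
  have hff : (1 - e) * (1 - e) = 1 - e := he.one_sub.eq
  obtain ⟨y, hy⟩ := exists_mul_mul_ne_zero he0 hf
  set q := e * y * (1 - e) with hq
  have heq : e * q = q := by rw [hq, ← mul_assoc, ← mul_assoc, he.eq]
  have hqf : q * (1 - e) = q := by rw [hq, mul_assoc, hff]
  by_cases hqR : q ∈ R
  · have : q ∈ T := hqf ▸ hT.left_mul_mem q hqR _ hfT
    exact hy (by rw [← heq, hez q this])
  · obtain ⟨r, _, hrq, hn⟩ := h.left q hqR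
    apply hn
    rw [← hqf, ← mul_assoc]
    exact mul_mem_idealPart hrq (hTP hfT)

variable [IsSimpleRing (R ⧸ M)] [IsArtinianRing (R ⧸ M)]

theorem exists_generator (hM : M ≠ ⊤) (h : HasMultiples R M) (hfg : M.FG) :
    ∃ p ∈ M, ∀ m ∈ M, ∃ r : R, r * p = m := by
  have hfin : Module.Finite R M := Module.Finite.iff_fg.2 hfg
  let V := M ⧸ (M • ⊤ : Submodule R M)
  have htor : Module.IsTorsionBySet R V M := fun v r => by
    obtain ⟨m, rfl⟩ := Submodule.Quotient.mk_surjective _ v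
    rw [← Submodule.Quotient.mk_smul, Submodule.Quotient.mk_eq_zero]
    exact Submodule.smul_mem_smul r.2 Submodule.mem_top
  let _ : Module (R ⧸ M) V := htor.module
  have hsmul : ∀ (r : R) (v : V), (Ideal.Quotient.mk M r) • v = r • v := fun _ _ => rfl
  have : Module.Finite (R ⧸ M) V := by
    obtain ⟨s, hs⟩ := (Module.Finite.fg_top : (⊤ : Submodule R V).FG)
    refine ⟨s, top_le_iff.1 fun v _ => ?_⟩
    have hv : v ∈ Submodule.span R (s : Set V) := hs ▸ Submodule.mem_top
    induction hv using Submodule.span_induction with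
    | mem x hx => exact Submodule.subset_span hx
    | zero => exact zero_mem _
    | add x y _ _ hx hy => exact add_mem (hx trivial) (hy trivial)
    | smul a x _ hx =>
      rw [← hsmul]
      exact Submodule.smul_mem _ _ (hx trivial)
  rcases exists_generator_or_equiv (R ⧸ M) V with ⟨v, hv⟩ | ⟨n, l, hnl, ⟨e⟩⟩
  · obtain ⟨p, rfl⟩ := Submodule.Quotient.mk_surjective _ v
    have key : (⊤ : Submodule R M) ≤ Submodule.span R {p} := by
      refine le_of_le_sup_jacobson_smul hfin.fg_top fun m _ => ?_
      obtain ⟨s, hs⟩ := hv (Submodule.Quotient.mk m)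
      obtain ⟨r, rfl⟩ := Ideal.Quotient.mk_surjective s
      rw [hsmul, ← Submodule.Quotient.mk_smul, eq_comm, Submodule.Quotient.eq] at hs
      rw [← add_sub_cancel (r • p) m]
      exact Submodule.add_mem_sup (Submodule.smul_mem _ _ (Submodule.mem_span_singleton_self p))
        (Submodule.smul_mono_left (eq_jacobson hM h).le hs)
    refine ⟨p, p.2, fun m hm => ?_⟩
    obtain ⟨r, hr⟩ := Submodule.mem_span_singleton.1 (key (Submodule.mem_top (x := ⟨m, hm⟩)))
    exact ⟨r, congrArg Subtype.val hr⟩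
  · exfalso
    -- The rows `c j` in `M ^ n` lift a basis of `(M / M²) ^ n`. They are independent over `A`: a
    -- relation, scaled to have coefficients in `R` not all in `M`, would reduce to a nontrivial
    -- relation over `R / M`.
    choose c hc using fun (j : Fin l) (i : Fin n) =>
      Submodule.Quotient.mk_surjective (M • ⊤ : Submodule R M) (e.symm (Pi.single j 1) i)
    have hinj : Function.Injective
        (Fintype.linearCombination A (fun (j : Fin l) (i : Fin n) => ((c j i : R) : A))) := by
      rw [injective_iff_map_eq_zero]
      intro x hx
      by_contra hx0
      obtain ⟨a, haR, i₀, hi₀⟩ := exists_mul_vec_mem hM h hx0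
      have h1 : ∀ i, ∑ j, (⟨a * x j, haR j⟩ : R) • c j i = 0 := fun i => by
        apply Subtype.ext
        apply Subtype.ext
        have := congrFun hx i
        simp only [Fintype.linearCombination_apply, Finset.sum_apply, Pi.smul_apply,
          smul_eq_mul, Pi.zero_apply] at this
        simp [mul_assoc, ← Finset.mul_sum, this]
      have h2 : ∑ j, Ideal.Quotient.mk M ⟨a * x j, haR j⟩ • e.symm (Pi.single j 1) = 0 := by
        ext i
        have := congrArg (Submodule.mkQ (M • ⊤ : Submodule R M)) (h1 i)
        simp only [map_sum, map_smul, map_zero, Submodule.mkQ_apply, hc] at this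
        simp only [Finset.sum_apply, Pi.smul_apply, hsmul]
        exact this
      have h3 := congrFun (congrArg e h2) i₀
      simp only [map_sum, map_smul, LinearEquiv.apply_symm_apply, map_zero, Finset.sum_apply,
        Pi.smul_apply, Pi.zero_apply, Pi.single_apply, smul_eq_mul, mul_ite, mul_one, mul_zero,
        Finset.sum_ite_eq, Finset.mem_univ, if_true] at h3
      exact hi₀ (mem_idealPart.2 ⟨haR i₀, Ideal.Quotient.eq_zero_iff_mem.1 h3⟩)
    exact absurd (le_of_fin_injective A _ hinj) (not_le.2 hnl)

/-- If `M ≠ 0` is finitely generated, then `M = p R = R p` for a unit `p` of `A`. -/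
theorem exists_unit_generator (hM : M ≠ ⊤) (hM0 : M ≠ ⊥) (h : HasMultiples R M) (hfg : M.FG) :
    ∃ p : Aˣ, (∀ a, a ∈ idealPart M ↔ a * ↑p⁻¹ ∈ R) ∧ (∀ a, a ∈ idealPart M ↔ ↑p⁻¹ * a ∈ R) := by
  obtain ⟨p, hp, hgen⟩ := exists_generator hM h hfg
  have htop : Ideal.span {(p : A)} = ⊤ := by
    rw [← top_le_iff, ← span_idealPart_eq_top hM hM0 h, Ideal.span_le]
    intro m hm
    obtain ⟨hmR, hm⟩ := mem_idealPart.1 hm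
    obtain ⟨r, hr⟩ := hgen _ hm
    exact Ideal.mem_span_singleton'.2 ⟨r, congrArg Subtype.val hr⟩
  obtain ⟨b, hb⟩ := Ideal.mem_span_singleton'.1 ((Ideal.eq_top_iff_one _).1 htop)
  obtain ⟨u, hu⟩ : ∃ u : Aˣ, (u : A) = p := ⟨⟨p, b, mul_eq_one_symm hb, hb⟩, rfl⟩
  have huP : (u : A) ∈ idealPart M := hu ▸ coe_mem_idealPart.2 hp
  have h1 : ∀ a, a ∈ idealPart M ↔ a * ↑u⁻¹ ∈ R := fun a => by
    constructor
    · intro ha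
      obtain ⟨haR, ha⟩ := mem_idealPart.1 ha
      obtain ⟨r, hr⟩ := hgen _ ha
      have : a = r * u := by rw [hu]; exact (congrArg Subtype.val hr).symm
      rw [this, Units.mul_inv_cancel_right]
      exact r.2
    · intro ha
      rw [← Units.inv_mul_cancel_right a u]
      exact mul_mem_idealPart ha huP
  refine ⟨u, h1, fun a => ⟨fun ha => ?_, fun ha => ?_⟩⟩
  -- From `M p⁻¹ ⊆ R` and `a ∈ M` follows `M p⁻¹ a ⊆ M`, so `p⁻¹ a` is in the right order of `M`.
  · refine mem_of_idealPart_mul_le h.left (exists_weak_compl M) fun m hm => ?_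
    rw [← mul_assoc]
    exact mul_mem_idealPart ((h1 m).1 hm) ha
  · rw [← Units.mul_inv_cancel_left u a]
    exact idealPart_mul_mem ha huP

end
-- The powers `p ^ k R`
section

variable {A : Type*} [Ring A] {R : Subring A} {M : Ideal R}

/-- `p` is a unit of `A` with `M = R p = p R`. -/
structure IsUniformizer (R : Subring A) (M : Ideal R) (p : Aˣ) : Prop where
  mem_iff_mul_inv : ∀ a, a ∈ idealPart M ↔ a * ↑p⁻¹ ∈ R
  mem_iff_inv_mul : ∀ a, a ∈ idealPart M ↔ ↑p⁻¹ * a ∈ R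

/-- The additive subgroup `p ^ k R`. -/
def powPart (R : Subring A) (p : Aˣ) (k : ℤ) : Submodule ℤ A :=
  (ringPart R).comap (LinearMap.mulLeft ℤ (↑(p ^ (-k)) : A))

theorem mem_powPart {p : Aˣ} {k : ℤ} {a : A} : a ∈ powPart R p k ↔ ↑(p ^ (-k)) * a ∈ R := Iff.rfl

theorem mem_powPart_neg {p : Aˣ} {k : ℤ} {a : A} : a ∈ powPart R p (-k) ↔ ↑(p ^ k) * a ∈ R := by
  rw [mem_powPart, neg_neg]

theorem powPart_zero {p : Aˣ} : powPart R p 0 = ringPart R := by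
  ext a
  rw [mem_powPart, neg_zero, zpow_zero, Units.val_one, one_mul]
  rfl

theorem zpow_mem_powPart_self {p : Aˣ} {k : ℤ} : (↑(p ^ k) : A) ∈ powPart R p k := by
  rw [mem_powPart, zpow_neg, Units.inv_mul]
  exact R.one_mem

theorem powPart_le_of_zpow_mem {p : Aˣ} {C : Submodule ℤ A} (hC : IsBimodule R C) {k : ℤ}
    (h : (↑(p ^ k) : A) ∈ C) : powPart R p k ≤ C := fun a ha => by
  have := hC.mul_right_mem _ (mem_powPart.1 ha) _ h
  rwa [zpow_neg, Units.mul_inv_cancel_left] at this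

namespace IsUniformizer

variable {p : Aˣ} (hp : IsUniformizer R M p)
include hp

theorem powPart_one : powPart R p 1 = idealPart M := by
  ext a
  rw [mem_powPart, hp.mem_iff_inv_mul, zpow_neg_one]

theorem conj_mem_iff (k : ℤ) (r : A) : ↑(p ^ k) * r * ↑(p ^ (-k)) ∈ R ↔ r ∈ R := by
  -- The normalizer of `R` in the unit group; it contains `p` because `R p = p R`.
  let S : Subgroup Aˣ :=
    { carrier := {u | ∀ r : A, ↑u * r * ↑u⁻¹ ∈ R ↔ r ∈ R}
      one_mem' := fun r => by simp
      mul_mem' := fun {u w} hu hw r => by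
        rw [← hw r, ← hu (w * r * ↑w⁻¹)]
        simp [mul_assoc]
      inv_mem' := fun {u} hu r => by
        rw [← hu (↑u⁻¹ * r * ↑u⁻¹⁻¹)]
        simp [mul_assoc] }
  have hpS : p ∈ S := fun r => by
    rw [← hp.mem_iff_mul_inv, hp.mem_iff_inv_mul, Units.inv_mul_cancel_left]
  have := S.zpow_mem hpS k r
  rwa [← zpow_neg] at this

theorem mem_powPart_iff {k : ℤ} {a : A} : a ∈ powPart R p k ↔ a * ↑(p ^ (-k)) ∈ R := by
  rw [mem_powPart, ← hp.conj_mem_iff k, zpow_neg, Units.mul_inv_cancel_left]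

theorem zpow_mul_mem {k l : ℤ} {a b : A} (ha : a ∈ powPart R p k) (hb : b ∈ powPart R p l) :
    a * b ∈ powPart R p (k + l) := by
  rw [mem_powPart, neg_add_rev, zpow_add, Units.val_mul]
  have h1 := (hp.conj_mem_iff (-l) _).2 (mem_powPart.1 ha)
  have := R.mul_mem h1 (mem_powPart.1 hb)
  rw [neg_neg] at this
  simpa [mul_assoc] using this

theorem zpow_mem_of_nonneg {k : ℤ} (hk : 0 ≤ k) : (↑(p ^ k) : A) ∈ R := by
  have h1 : (p : A) ∈ R := idealPart_subset ((hp.mem_iff_mul_inv p).2 (by simp [R.one_mem]))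
  obtain ⟨n, rfl⟩ := Int.eq_ofNat_of_zero_le hk
  simpa using R.pow_mem h1 n

theorem zpow_mem_iff (hM : M ≠ ⊤) {k : ℤ} : (↑(p ^ k) : A) ∈ R ↔ 0 ≤ k := by
  refine ⟨fun h => ?_, hp.zpow_mem_of_nonneg⟩
  by_contra! hk
  apply one_notMem_idealPart hM
  rw [hp.mem_iff_mul_inv, one_mul, ← zpow_neg_one, show (-1 : ℤ) = (-k - 1) + k by ring, zpow_add,
    Units.val_mul]
  exact R.mul_mem (hp.zpow_mem_of_nonneg (by lia)) h

theorem zpow_mem_powPart_iff (hM : M ≠ ⊤) {k l : ℤ} : (↑(p ^ k) : A) ∈ powPart R p l ↔ l ≤ k := by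
  rw [mem_powPart, ← Units.val_mul, ← zpow_add, hp.zpow_mem_iff hM]
  lia

theorem isBimodule_powPart (k : ℤ) : IsBimodule R (powPart R p k) where
  left_mul_mem r hr x hx := by
    simpa using hp.zpow_mul_mem (k := 0) (by rwa [powPart_zero]) hx
  mul_right_mem r hr x hx := by
    simpa using hp.zpow_mul_mem (l := 0) hx (by rwa [powPart_zero])

theorem powPart_le_powPart_iff (hM : M ≠ ⊤) {k l : ℤ} :
    powPart R p k ≤ powPart R p l ↔ l ≤ k :=
  ⟨fun h => (hp.zpow_mem_powPart_iff hM).1 (h zpow_mem_powPart_self), fun h =>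
    powPart_le_of_zpow_mem (hp.isBimodule_powPart l) ((hp.zpow_mem_powPart_iff hM).2 h)⟩

theorem powPart_mul (k l : ℤ) : powPart R p k * powPart R p l = powPart R p (k + l) := by
  apply le_antisymm
  · exact Submodule.mul_le.2 fun a ha b hb => hp.zpow_mul_mem ha hb
  · intro a ha
    rw [← Units.mul_inv_cancel_left (p ^ k) a]
    refine Submodule.mul_mem_mul zpow_mem_powPart_self ?_
    rw [mem_powPart, ← mul_assoc, ← zpow_neg, ← Units.val_mul, ← zpow_add, ← neg_add_rev]
    rwa [mem_powPart] at ha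

theorem isFracIdeal_powPart (k : ℤ) : IsFracIdeal R (powPart R p k) := by
  have hreg : ∀ j : ℤ, ∀ hj : 0 ≤ j,
      IsRegular (⟨↑(p ^ j), hp.zpow_mem_of_nonneg hj⟩ : R) := fun j hj =>
    ⟨fun x y hxy => Subtype.ext ((p ^ j).isUnit.isRegular.left (congrArg Subtype.val hxy)),
      fun x y hxy => Subtype.ext ((p ^ j).isUnit.isRegular.right (congrArg Subtype.val hxy))⟩
  -- `p ^ |k|` serves both as the regular element and as the denominator, since `|k| - k` and `|k| +
  -- k` are nonnegative.
  refine ⟨(hp.isBimodule_powPart k).1, (hp.isBimodule_powPart k).2, ⟨_, hreg |k| (abs_nonneg k), ?_⟩,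
    ⟨_, hreg |k| (abs_nonneg k), fun x hx => ?_⟩⟩
  · rw [mem_powPart, ← Units.val_mul, ← zpow_add]
    exact hp.zpow_mem_of_nonneg (by linarith [le_abs_self k])
  · have := R.mul_mem (hp.zpow_mem_of_nonneg (k := |k| + k) (by linarith [neg_abs_le k]))
      (mem_powPart.1 hx)
    rwa [← mul_assoc, ← Units.val_mul, ← zpow_add, add_neg_cancel_right] at this

end IsUniformizer

/-- The ring `⋃ p ^ (-k) R`. -/
def unionPow {p : Aˣ} (hp : IsUniformizer R M p) : Subring A where
  carrier := {a | ∃ k : ℕ, a ∈ powPart R p (-k)}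
  zero_mem' := ⟨0, zero_mem _⟩
  one_mem' := ⟨0, by rw [mem_powPart_neg]; simp [R.one_mem]⟩
  add_mem' := by
    have key : ∀ {j k : ℤ} {a : A}, k ≤ j → a ∈ powPart R p j → a ∈ powPart R p k :=
      fun {j k a} hjk ha => powPart_le_of_zpow_mem (hp.isBimodule_powPart k)
        (by rw [mem_powPart, ← Units.val_mul, ← zpow_add]
            exact hp.zpow_mem_of_nonneg (by lia)) ha
    rintro a b ⟨k, ha⟩ ⟨l, hb⟩
    exact ⟨k + l, add_mem (key (by lia) ha) (key (by lia) hb)⟩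
  neg_mem' := by
    rintro a ⟨k, ha⟩
    exact ⟨k, neg_mem ha⟩
  mul_mem' := by
    rintro a b ⟨k, ha⟩ ⟨l, hb⟩
    refine ⟨k + l, ?_⟩
    rw [Nat.cast_add, neg_add]
    exact hp.zpow_mul_mem ha hb

theorem le_unionPow {p : Aˣ} (hp : IsUniformizer R M p) : R ≤ unionPow hp := fun a ha =>
  ⟨0, by simpa [powPart_zero] using! ha⟩

theorem zpow_mem_unionPow {p : Aˣ} (hp : IsUniformizer R M p) (k : ℤ) : (↑(p ^ k) : A) ∈ unionPow hp :=
  ⟨k.natAbs, by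
    rw [mem_powPart, ← Units.val_mul, ← zpow_add]
    exact hp.zpow_mem_of_nonneg (by lia)⟩

/-- Regularity is only assumed inside `R`. If `q r = 0` with `q ∉ R`, a multiple `s q ∈ R \ M` is
also killed by `r`, hence is `0 ∈ M`. -/
theorem isUnit_of_isRegular [IsArtinianRing A] (h : HasMultiples R M) {r : R} (hr : IsRegular r) :
    IsUnit (r : A) := by
  rw [IsArtinianRing.isUnit_iff_isRightRegular]
  have hz : ∀ q : A, q * r = 0 → q = 0 := fun q hq => by
    have hz' : ∀ s : R, (s : A) * r = 0 → s = 0 := fun s hs =>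
      hr.right (by simpa using Subtype.ext hs)
    by_cases hqR : q ∈ R
    · exact congrArg Subtype.val (hz' ⟨q, hqR⟩ hq)
    · obtain ⟨s, hs, hsq, hn⟩ := h.left q hqR
      refine absurd ?_ hn
      have := congrArg Subtype.val (hz' ⟨_, hsq⟩ (by simp [mul_assoc, hq]))
      rw [show s * q = 0 from this]
      exact zero_mem _
  exact fun x y hxy => sub_eq_zero.1 (hz _ (by rw [sub_mul]; exact sub_eq_zero.2 hxy))

end

/-! ### Bimodules between the powers; `A = ⋃ p ^ (-k) R` -/

section

variable {A : Type*} [Ring A] [IsSimpleRing A] [IsArtinianRing A] {R : Subring A}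
  {M : Ideal R} [M.IsTwoSided] [IsSimpleRing (R ⧸ M)] {p : Aˣ}

/-- The dichotomy `one_mem_or_le` for `p ^ (-k) C`, again a bimodule because `p` normalizes `R`. -/
theorem zpow_mem_or_le (hM : M ≠ ⊤) (h : HasMultiples R M) (hp : IsUniformizer R M p)
    {C : Submodule ℤ A} (hC : IsBimodule R C) (k : ℤ) :
    (↑(p ^ k) : A) ∈ C ∨ C ≤ powPart R p (k + 1) := by
  let C' : Submodule ℤ A := C.comap (LinearMap.mulLeft ℤ (↑(p ^ k) : A))
  have hmem : ∀ a, a ∈ C' ↔ ↑(p ^ k) * a ∈ C := fun _ => Iff.rfl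
  have hC' : IsBimodule R C' :=
    { left_mul_mem := fun r hr x hx => by
        rw [hmem] at *
        have := hC.left_mul_mem _ ((hp.conj_mem_iff k r).2 hr) _ hx
        simpa [mul_assoc] using this
      mul_right_mem := fun r hr x hx => by
        rw [hmem] at *
        rw [← mul_assoc]
        exact hC.mul_right_mem r hr _ hx }
  refine (one_mem_or_le hM h hC').imp (fun h1 => by simpa [hmem] using h1) fun hle c hc => ?_
  have := hle (show ↑(p ^ (-k)) * c ∈ C' by
    rwa [hmem, zpow_neg, Units.mul_inv_cancel_left])
  rwa [hp.mem_iff_inv_mul, ← mul_assoc, ← zpow_neg_one, ← Units.val_mul, ← zpow_add,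
    ← neg_add_rev] at this

variable [IsArtinianRing (R ⧸ M)]

/-- The intersection `N` satisfies `N = p N ⊆ M N`, so it vanishes by Nakayama. -/
theorem eq_zero_of_forall_mem_powPart [IsNoetherianRing R] (hM : M ≠ ⊤) (h : HasMultiples R M)
    (hp : IsUniformizer R M p) {a : A} (ha : ∀ k : ℕ, a ∈ powPart R p k) : a = 0 := by
  let N : Ideal R :=
    { carrier := {r | ∀ k : ℕ, (r : A) ∈ powPart R p k}
      zero_mem' := fun k => zero_mem _
      add_mem' := fun hx hy k => add_mem (hx k) (hy k)
      smul_mem' := fun c x hx k => (hp.isBimodule_powPart k).left_mul_mem c c.2 x (hx k) }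
  have hN : N = ⊥ := by
    refine (IsNoetherian.noetherian N).eq_bot_of_le_jacobson_smul fun x hx => ?_
    have hpM : (p : A) ∈ idealPart M := (hp.mem_iff_mul_inv p).2 (by simp [R.one_mem])
    have hx1 : ∀ k : ℕ, ↑p⁻¹ * (x : A) ∈ powPart R p k := fun k => by
      have := hx (k + 1)
      rw [mem_powPart] at this ⊢
      rw [← zpow_neg_one, ← mul_assoc, ← Units.val_mul, ← zpow_add]
      convert this using 4
      push_cast; ring
    have hxR : ↑p⁻¹ * (x : A) ∈ R := by simpa [powPart_zero] using! hx1 0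
    have hxp : x = (⟨p, idealPart_subset hpM⟩ : R) • ⟨_, hxR⟩ :=
      Subtype.ext (by simp)
    rw [hxp, ← eq_jacobson hM h]
    exact Submodule.smul_mem_smul (coe_mem_idealPart.1 hpM) hx1
  have haR : a ∈ R := by simpa [powPart_zero] using! ha 0
  have : (⟨a, haR⟩ : R) ∈ N := ha
  rw [hN] at this
  exact congrArg Subtype.val this

/-- Sending a left ideal `V` to the image of `V ∩ R` in `R / M` is strictly monotone. Indeed `V`
absorbs `p⁻¹`, so `V ∩ M = p (V ∩ R)` and Nakayama recovers `V ∩ R` from its image; and `V ∩ R`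
determines `V` by clearing powers of `p`. -/
theorem isArtinianRing_unionPow [IsNoetherianRing R] (hM : M ≠ ⊤) (h : HasMultiples R M)
    (hp : IsUniformizer R M p) : IsArtinianRing (unionPow hp) := by
  let ι : R →+* unionPow hp := Subring.inclusion (le_unionPow hp)
  let φ : Ideal (unionPow hp) → Ideal (R ⧸ M) := fun V =>
    (V.comap ι).map (Ideal.Quotient.mk M)
  have hφ : ∀ V V', V ≤ V' → φ V' ≤ φ V → V' ≤ V := by
    intro V V' hV hφV
    have h0 : V'.comap ι ≤ V.comap ι := by
      refine le_of_le_sup_jacobson_smul (IsNoetherian.noetherian _) fun x hx => ?_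
      obtain ⟨z, hz, hzx⟩ := (Ideal.mem_map_iff_of_surjective _ Ideal.Quotient.mk_surjective).1
        (hφV (Ideal.mem_map_of_mem _ hx))
      have hxz : x - z ∈ M := Ideal.Quotient.eq.1 hzx.symm
      have hxz' : x - z ∈ V'.comap ι := sub_mem hx (Ideal.comap_mono hV hz)
      rw [← add_sub_cancel z x]
      refine Submodule.add_mem_sup hz ?_
      have hpM : (p : A) ∈ idealPart M := (hp.mem_iff_mul_inv p).2 (by simp [R.one_mem])
      have hyR := (hp.mem_iff_inv_mul _).1 (coe_mem_idealPart.2 hxz)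
      have hxp : x - z = (⟨p, idealPart_subset hpM⟩ : R) • ⟨_, hyR⟩ :=
        Subtype.ext (by simp)
      rw [hxp, ← eq_jacobson hM h]
      refine Submodule.smul_mem_smul (coe_mem_idealPart.1 hpM) ?_
      have := V'.mul_mem_left ⟨_, zpow_mem_unionPow hp (-1)⟩ hxz'
      rw [Ideal.mem_comap]
      convert this using 1
      exact Subtype.ext (by simp [ι])
    intro v hv
    obtain ⟨k, hk⟩ := v.2
    rw [mem_powPart_neg] at hk
    have h1 : (⟨_, hk⟩ : R) ∈ V'.comap ι :=
      V'.mul_mem_left ⟨_, zpow_mem_unionPow hp k⟩ hv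
    have h2 := V.mul_mem_left ⟨_, zpow_mem_unionPow hp (-k)⟩ (h0 h1)
    convert h2 using 1
    apply Subtype.ext
    change (v : A) = ↑(p ^ (-(k : ℤ))) * (↑(p ^ (k : ℤ)) * (v : A))
    rw [zpow_neg, Units.inv_mul_cancel_left]
  have hmono : Monotone φ := fun V V' hV => Ideal.map_mono (Ideal.comap_mono hV)
  have hstrict : StrictMono φ := fun V V' hV =>
    lt_of_le_not_ge (hmono hV.le) fun hc => hV.not_ge (hφ V V' hV.le hc)
  exact hstrict.wellFoundedLT

theorem isSimpleRing_unionPow [IsNoetherianRing R] (hM : M ≠ ⊤) (h : HasMultiples R M)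
    (hp : IsUniformizer R M p) : IsSimpleRing (unionPow hp) := by
  refine isSimpleRing_iff_isTwoSided_imp.2 ⟨inferInstance, fun I hI => or_iff_not_imp_left.2 fun h0 => ?_⟩
  obtain ⟨x, hxI, hx0⟩ := Submodule.exists_mem_ne_zero_of_ne_bot h0
  have hC : IsBimodule R (idealPart I) :=
    ⟨fun r hr x hx => mul_mem_idealPart (le_unionPow hp hr) hx,
      fun r hr x hx => idealPart_mul_mem (le_unionPow hp hr) hx⟩
  obtain ⟨k, hk⟩ : ∃ k : ℕ, (x : A) ∉ powPart R p k := by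
    by_contra! hc
    exact hx0 (Subtype.ext (eq_zero_of_forall_mem_powPart hM h hp hc))
  have h1 := (zpow_mem_or_le hM h hp hC (k - 1)).resolve_right fun hle =>
    hk (by simpa using hle (coe_mem_idealPart.2 hxI))
  have h2 := mul_mem_idealPart (zpow_mem_unionPow hp (-(k - 1))) h1
  rw [← Units.val_mul, ← zpow_add, neg_add_cancel, zpow_zero, Units.val_one] at h2
  by_contra ht
  exact one_notMem_idealPart ht h2

/-- The union is semisimple and elements outside it have nonzero left multiples in it. So the right
order criterion `mem_of_idealPart_mul_le` applies to its zero ideal, whose right order is all of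
`A`. -/
theorem unionPow_eq_top [IsNoetherianRing R] (hM : M ≠ ⊤) (h : HasMultiples R M)
    (hp : IsUniformizer R M p) (a : A) : a ∈ unionPow hp := by
  have := isArtinianRing_unionPow hM h hp
  have := isSimpleRing_unionPow hM h hp
  have : IsSemisimpleRing (unionPow hp ⧸ (⊥ : Ideal (unionPow hp))) :=
    (RingEquiv.quotientBot (unionPow hp)).symm.isSemisimpleRing
  refine mem_of_idealPart_mul_le (M := (⊥ : Ideal (unionPow hp))) (fun q hq => ?_)
    (exists_weak_compl ⊥) fun m hm => ?_
  · obtain ⟨r, hr, hrq, hn⟩ := h.left q fun hqR => hq (le_unionPow hp hqR)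
    refine ⟨r, le_unionPow hp hr, le_unionPow hp hrq, fun hb => hn ?_⟩
    obtain ⟨_, hb⟩ := mem_idealPart.1 hb
    have : r * q = 0 := congrArg Subtype.val hb
    rw [this]
    exact zero_mem _
  · obtain ⟨_, hb⟩ := mem_idealPart.1 hm
    have : m = 0 := congrArg Subtype.val hb
    rw [this, zero_mul]
    exact zero_mem _

theorem exists_eq_powPart [IsNoetherianRing R] (hM : M ≠ ⊤) (h : HasMultiples R M)
    (hp : IsUniformizer R M p) {C : Submodule ℤ A} (hC : IsBimodule R C) (hC0 : C ≠ ⊥)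
    (hb : ∃ m : ℤ, C ≤ powPart R p m) : ∃ k, C = powPart R p k := by
  obtain ⟨m, hm⟩ := hb
  obtain ⟨x, hxC, hx0⟩ := Submodule.exists_mem_ne_zero_of_ne_bot hC0
  obtain ⟨k, hk⟩ : ∃ k : ℕ, x ∉ powPart R p k := by
    by_contra! hc
    exact hx0 (eq_zero_of_forall_mem_powPart hM h hp hc)
  -- The least exponent `l` with `p ^ l ∈ C`: bounded below by `m`, and present because `x ∉ p ^ k
  -- R` forces `p ^ (k - 1) ∈ C`. Then `p ^ (l - 1) ∉ C` gives `C ⊆ p ^ l R`.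
  obtain ⟨l, hl, hmin⟩ := Int.exists_least_of_bdd (P := fun k => (↑(p ^ k) : A) ∈ C)
    ⟨m, fun z hz => (hp.zpow_mem_powPart_iff hM).1 (hm hz)⟩
    ⟨k - 1, (zpow_mem_or_le hM h hp hC (k - 1)).resolve_right fun hle =>
      hk (by simpa using hle hxC)⟩
  refine ⟨l, le_antisymm ?_ (powPart_le_of_zpow_mem hC hl)⟩
  have := (zpow_mem_or_le hM h hp hC (l - 1)).resolve_left fun hc => by
    have := hmin _ hc
    lia
  simpa using this

end
-- The ordered set `Γ` and its group structure
section

variable {A : Type*} [Ring A] {R : Subring A}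

theorem colon_anti {I J : Submodule ℤ A} (h : I ≤ J) : colon R J ≤ colon R I :=
  fun _ ha x hx => ha x (h hx)

theorem le_colon_sup {I J S : Submodule ℤ A} (hI : S ≤ colon R I) (hJ : S ≤ colon R J) :
    S ≤ colon R (I ⊔ J) := fun a ha x hx => by
  obtain ⟨y, hy, z, hz, rfl⟩ := Submodule.mem_sup.1 hx
  rw [mul_add]
  exact add_mem (hI ha y hy) (hJ ha z hz)

theorem isBimodule_principal (R : Subring A) (a : A) : IsBimodule R (principal R a) where
  left_mul_mem r hr x hx := by
    induction hx using Submodule.span_induction with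
    | mem x hx =>
      obtain ⟨s, hs, t, ht, rfl⟩ := hx
      exact Submodule.subset_span ⟨r * s, R.mul_mem hr hs, t, ht, by simp [mul_assoc]⟩
    | zero => simp
    | add x y _ _ hx hy => rw [mul_add]; exact add_mem hx hy
    | smul n x _ hx => rw [mul_smul_comm]; exact Submodule.smul_mem _ _ hx
  mul_right_mem r hr x hx := by
    induction hx using Submodule.span_induction with
    | mem x hx =>
      obtain ⟨s, hs, t, ht, rfl⟩ := hx
      exact Submodule.subset_span ⟨s, hs, t * r, R.mul_mem ht hr, by simp [mul_assoc]⟩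
    | zero => simp
    | add x y _ _ hx hy => rw [add_mul]; exact add_mem hx hy
    | smul n x _ hx => rw [smul_mul_assoc]; exact Submodule.smul_mem _ _ hx

theorem self_mem_principal (R : Subring A) (a : A) : a ∈ principal R a :=
  Submodule.subset_span ⟨1, R.one_mem, 1, R.one_mem, by simp⟩

theorem principal_le_iff {C : Submodule ℤ A} (hC : IsBimodule R C) {a : A} :
    principal R a ≤ C ↔ a ∈ C := by
  refine ⟨fun h => h (self_mem_principal R a), fun h => Submodule.span_le.2 ?_⟩
  rintro _ ⟨r, hr, s, hs, rfl⟩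
  exact hC.mul_right_mem s hs _ (hC.left_mul_mem r hr a h)

/-- An order isomorphism of a totally ordered group with `Γ`, for which `v` is multiplicative,
carries its group structure to `Γ`. -/
theorem exists_addGroup_valueSet {G : Type*} [AddGroup G] [LinearOrder G] [AddLeftMono G]
    [AddRightMono G] (e : ValueSet R ≃o G)
    (hmul : ∀ I J, e (val R (I * J)) = e (val R I) + e (val R J)) (hone : e (val R 1) = 0)
    (hfrac : ∀ a : A, a ≠ 0 → IsFracIdeal R (principal R a))
    (hrad : ∀ a : A, ∀ h : a ≠ 0, a ∈ radPart R ↔ 0 < e (val R ⟨principal R a, hfrac a h⟩))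
    (hring : ∀ a : A, ∀ h : a ≠ 0, a ∈ R ↔ 0 ≤ e (val R ⟨principal R a, hfrac a h⟩)) :
    ∃ (_ : AddGroup (ValueSet R)) (_ : AddLeftMono (ValueSet R)) (_ : AddRightMono (ValueSet R)),
      (∀ γ δ : ValueSet R, γ ≤ δ ∨ δ ≤ γ) ∧
      IsArithmeticalPseudoValuation R (val R) ∧
      (∀ a : A, a ≠ 0 → IsFracIdeal R (principal R a)) ∧
      (radPart R : Set A) =
        {a | a = 0 ∨ ∃ h : IsFracIdeal R (principal R a), 0 < val R ⟨principal R a, h⟩} ∧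
      (R : Set A) =
        {a | a = 0 ∨ ∃ h : IsFracIdeal R (principal R a), 0 ≤ val R ⟨principal R a, h⟩} := by
  let _ : AddGroup (ValueSet R) := e.toEquiv.addGroup
  have hadd : ∀ x y, e (x + y) = e x + e y := fun x y => e.toEquiv.apply_symm_apply _
  have hzero : e 0 = 0 := e.toEquiv.apply_symm_apply _
  have hL : AddLeftMono (ValueSet R) := ⟨fun z x y hxy => by
    rw [← e.le_iff_le, hadd, hadd]
    exact add_le_add_right (e.le_iff_le.2 hxy) _⟩
  have hR : AddRightMono (ValueSet R) := ⟨fun z x y hxy => by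
    rw [← e.le_iff_le]
    change e (x + z) ≤ e (y + z)
    rw [hadd, hadd]
    exact add_le_add_left (e.le_iff_le.2 hxy) _⟩
  refine ⟨inferInstance, hL, hR, fun γ δ => ?_, ⟨fun I J => ?_, fun I J γ h1 h2 => ?_, ?_, ?_⟩,
    hfrac, ?_, ?_⟩
  · rw [← e.le_iff_le, ← e.le_iff_le]
    exact le_total _ _
  · apply e.injective
    rw [hmul, hadd]
  · exact le_colon_sup (R := R) h1 h2
  · apply e.injective
    rw [hone, hzero]
  · exact fun I J h => colon_anti (R := R) h
  · ext a
    by_cases ha : a = 0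
    · simp [ha]
    · have : (∃ h, 0 < val R ⟨principal R a, h⟩) ↔ a ∈ radPart R := by
        rw [hrad a ha, ← hzero, e.lt_iff_lt]
        exact ⟨fun ⟨_, h⟩ => h, fun h => ⟨_, h⟩⟩
      simpa [ha] using this.symm
  · ext a
    by_cases ha : a = 0
    · simp [ha, R.zero_mem]
    · have : (∃ h, 0 ≤ val R ⟨principal R a, h⟩) ↔ a ∈ R := by
        rw [hring a ha, ← hzero, e.le_iff_le]
        exact ⟨fun ⟨_, h⟩ => h, fun h => ⟨_, h⟩⟩
      simpa [ha] using this.symm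

theorem colon_powPart {M : Ideal R} {p : Aˣ} (hp : IsUniformizer R M p)
    (hP : radPart R = idealPart M) (k : ℤ) : colon R (powPart R p k) = powPart R p (1 - k) := by
  ext a
  constructor
  · intro ha
    have := ha _ (zpow_mem_powPart_self (R := R) (p := p) (k := k))
    rw [hP, hp.mem_iff_mul_inv, mul_assoc, ← zpow_neg_one, ← Units.val_mul, ← zpow_add] at this
    rw [hp.mem_powPart_iff]
    convert this using 4
    ring
  · intro ha x hx
    rw [hP, ← hp.powPart_one]
    simpa using hp.zpow_mul_mem ha hx

/-- If all fractional ideals are powers of `p`, then `Γ` is order isomorphic to `ℤ`. -/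
theorem exists_orderIso_int {M : Ideal R} {p : Aˣ} (hM : M ≠ ⊤) (hp : IsUniformizer R M p)
    (hP : radPart R = idealPart M)
    (hpow : ∀ I : Submodule ℤ A, IsFracIdeal R I → ∃ k, I = powPart R p k) :
    ∃ e : ValueSet R ≃o ℤ, ∀ (k : ℤ) (I : FracIdeal R), I.1 = powPart R p k → e (val R I) = k := by
  -- Both `k ↦ p ^ k R` and `I ↦ (P : I)` reverse order, so `f` preserves it.
  let f : ℤ → ValueSet R := fun k => val R ⟨powPart R p k, hp.isFracIdeal_powPart k⟩
  have hf : ∀ k l, f k ≤ f l ↔ k ≤ l := fun k l => by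
    change colon R (powPart R p k) ≤ colon R (powPart R p l) ↔ _
    rw [colon_powPart hp hP, colon_powPart hp hP, hp.powPart_le_powPart_iff hM]
    lia
  have hval : ∀ (k : ℤ) (I : FracIdeal R), I.1 = powPart R p k → f k = val R I := by
    rintro k ⟨I, hI⟩ rfl
    rfl
  have hsurj : Function.Surjective f := by
    rintro ⟨_, I, rfl⟩
    obtain ⟨k, hk⟩ := hpow I.1 I.2
    exact ⟨k, hval k I hk⟩
  let E : ℤ ↪o ValueSet R := OrderEmbedding.ofMapLEIff f hf
  refine ⟨(RelIso.ofSurjective E hsurj).symm, fun k I hI => ?_⟩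
  rw [← hval k I hI]
  exact (RelIso.ofSurjective E hsurj).symm_apply_apply k

theorem IsDubrovinValuationRing.exists_hasMultiples (hR : IsDubrovinValuationRing R) :
    ∃ (M : Ideal R) (_ : M.IsTwoSided), IsSimpleRing (R ⧸ M) ∧ IsArtinianRing (R ⧸ M) ∧
      HasMultiples R M := by
  obtain ⟨M, hM, h1, h2, h3⟩ := hR
  refine ⟨M, hM, h1, h2, fun q hq => ?_, fun q hq => ?_⟩
  · obtain ⟨r, hr, h, hn⟩ := (h3 q hq).1
    exact ⟨r, hr, h, fun hc => hn (mem_idealPart.1 hc).2⟩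
  · obtain ⟨r, hr, h, hn⟩ := (h3 q hq).2
    exact ⟨r, hr, h, fun hc => hn (mem_idealPart.1 hc).2⟩

theorem IsFracIdeal.isBimodule {I : Submodule ℤ A} (hI : IsFracIdeal R I) : IsBimodule R I :=
  ⟨hI.left_mul_mem, hI.mul_right_mem⟩

theorem IsFracIdeal.ne_bot [Nontrivial A] {I : Submodule ℤ A} (hI : IsFracIdeal R I) : I ≠ ⊥ := by
  rintro rfl
  obtain ⟨u, hu, hu0⟩ := hI.exists_regular
  exact hu.ne_zero (Subtype.ext hu0)

end

/-! ### Fractional ideals and principal bimodules are powers of `p` -/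

section

variable {A : Type*} [Ring A] [IsSimpleRing A] [IsArtinianRing A] {R : Subring A}
  {M : Ideal R} [M.IsTwoSided] [IsSimpleRing (R ⧸ M)] [IsArtinianRing (R ⧸ M)] {p : Aˣ}

theorem IsFracIdeal.eq_powPart [IsNoetherianRing R] (hM : M ≠ ⊤) (h : HasMultiples R M)
    (hp : IsUniformizer R M p) {I : Submodule ℤ A} (hI : IsFracIdeal R I) :
    ∃ k, I = powPart R p k := by
  refine exists_eq_powPart hM h hp hI.isBimodule hI.ne_bot ?_
  obtain ⟨r, hr, hrI⟩ := hI.exists_denom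
  obtain ⟨u, hu⟩ := isUnit_of_isRegular h hr
  obtain ⟨k, hk⟩ := unionPow_eq_top hM h hp (↑u⁻¹ : A)
  refine ⟨-k, fun x hx => ?_⟩
  have := (hp.isBimodule_powPart (-k)).mul_right_mem _ (hrI x hx) _ hk
  rwa [← hu, Units.inv_mul_cancel_left] at this

theorem principal_eq_powPart [IsNoetherianRing R] (hM : M ≠ ⊤) (h : HasMultiples R M)
    (hp : IsUniformizer R M p) {a : A} (ha : a ≠ 0) : ∃ k, principal R a = powPart R p k := by
  refine exists_eq_powPart hM h hp (isBimodule_principal R a) ?_ ?_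
  · intro h0
    have := self_mem_principal R a
    rw [h0] at this
    exact ha this
  · obtain ⟨k, hk⟩ := unionPow_eq_top hM h hp a
    exact ⟨-k, (principal_le_iff (hp.isBimodule_powPart _)).2 hk⟩

end
end Dubrovin

theorem mainTheorem2 {A : Type*} [Ring A] [IsSimpleRing A] [IsArtinianRing A] (R : Subring A)
    (hR : Dubrovin.IsDubrovinValuationRing R) (hN : Dubrovin.IsTwoSidedNoetherian R) :
    ∃ (_ : AddGroup (Dubrovin.ValueSet R)) (_ : AddLeftMono (Dubrovin.ValueSet R))
      (_ : AddRightMono (Dubrovin.ValueSet R)),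
      (∀ γ δ : Dubrovin.ValueSet R, γ ≤ δ ∨ δ ≤ γ) ∧
      Dubrovin.IsArithmeticalPseudoValuation R (Dubrovin.val R) ∧
      (∀ a : A, a ≠ 0 → Dubrovin.IsFracIdeal R (Dubrovin.principal R a)) ∧
      (Dubrovin.radPart R : Set A) =
        {a | a = 0 ∨ ∃ h : Dubrovin.IsFracIdeal R (Dubrovin.principal R a),
          0 < Dubrovin.val R ⟨Dubrovin.principal R a, h⟩} ∧
      (R : Set A) =
        {a | a = 0 ∨ ∃ h : Dubrovin.IsFracIdeal R (Dubrovin.principal R a),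
          0 ≤ Dubrovin.val R ⟨Dubrovin.principal R a, h⟩} := by
  open Dubrovin in
  obtain ⟨M, hMt, hs, ha, h⟩ := hR.exists_hasMultiples
  have := hN.1
  have hM : M ≠ ⊤ := Ideal.Quotient.nontrivial_iff.1 inferInstance
  have hP : radPart R = idealPart M := by
    rw [eq_jacobson hM h]
    rfl
  -- When `M = 0`, its right order is `A`, so `R = A`; nonzero bimodules are all of `A` and `Γ` has
  -- one element.
  by_cases hM0 : M = ⊥
  · subst hM0
    have hb : ∀ x, x ∈ idealPart (⊥ : Ideal R) ↔ x = 0 := fun x => by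
      rw [mem_idealPart]
      exact ⟨fun ⟨_, hx⟩ => congrArg Subtype.val hx, fun hx => ⟨hx ▸ R.zero_mem, Subtype.ext hx⟩⟩
    have hall : ∀ a : A, a ∈ R := fun a =>
      mem_of_idealPart_mul_le h.left (exists_weak_compl _) fun m hm => by
        rw [hb] at hm ⊢
        rw [hm, zero_mul]
    have htop : ∀ C : Submodule ℤ A, IsBimodule R C → C ≠ ⊥ → C = ⊤ := fun C hC hC0 => by
      refine top_le_iff.1 fun a _ => ?_
      have h1 := (one_mem_or_le hM h hC).resolve_right fun hle =>
        hC0 (le_bot_iff.1 fun x hx => (hb x).1 (hle hx))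
      simpa using hC.left_mul_mem a (hall a) 1 h1
    have hsub : ∀ I J : FracIdeal R, I = J := fun I J => Subtype.ext
      ((htop _ I.2.isBimodule I.2.ne_bot).trans (htop _ J.2.isBimodule J.2.ne_bot).symm)
    have hsub' : Subsingleton (ValueSet R) := ⟨by
      rintro ⟨_, I, rfl⟩ ⟨_, J, rfl⟩
      rw [hsub I J]⟩
    let _ : Unique (ValueSet R) := ⟨⟨val R 1⟩, fun _ => Subsingleton.elim _ _⟩
    let e : ValueSet R ≃o PUnit.{1} := OrderIso.ofUnique _ _
    refine exists_addGroup_valueSet e (fun _ _ => rfl) rfl (fun a ha => ?_) (fun a ha => ?_)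
      (fun a _ => ⟨fun _ => le_rfl, fun _ => hall a⟩)
    · have : principal R a = ringPart R := by
        rw [htop _ (isBimodule_principal R a) fun h0 => ha ?_]
        · exact (top_le_iff.1 fun a _ => hall a).symm
        · simpa [h0] using self_mem_principal R a
      rw [this]
      exact isFracIdeal_ringPart R
    · rw [hP, hb]
      exact ⟨fun h0 => absurd h0 ha, fun h0 => absurd h0 (lt_irrefl _)⟩
  · obtain ⟨p, h1, h2⟩ := exists_unit_generator hM hM0 h (IsNoetherian.noetherian M)
    have hp : IsUniformizer R M p := ⟨h1, h2⟩
    obtain ⟨e, he⟩ := exists_orderIso_int hM hp hP fun I hI => hI.eq_powPart hM h hp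
    have hfrac : ∀ a : A, a ≠ 0 → IsFracIdeal R (principal R a) := fun a ha => by
      obtain ⟨k, hk⟩ := principal_eq_powPart hM h hp ha
      rw [hk]
      exact hp.isFracIdeal_powPart k
    -- The cases `l = 1` and `l = 0` are the descriptions of `P` and `R`.
    have hmem : ∀ (a : A) (ha : a ≠ 0) (l : ℤ),
        a ∈ powPart R p l ↔ l ≤ e (val R ⟨principal R a, hfrac a ha⟩) := fun a ha l => by
      obtain ⟨k, hk⟩ := principal_eq_powPart hM h hp ha
      rw [he k _ hk, ← principal_le_iff (hp.isBimodule_powPart l), hk,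
        hp.powPart_le_powPart_iff hM]
    refine exists_addGroup_valueSet e (fun I J => ?_) (he 0 _ powPart_zero.symm) hfrac
      (fun a ha => ?_) (fun a ha => ?_)
    · obtain ⟨k, hk⟩ := I.2.eq_powPart hM h hp
      obtain ⟨l, hl⟩ := J.2.eq_powPart hM h hp
      rw [he k I hk, he l J hl]
      refine he _ _ ?_
      rw [← hp.powPart_mul, ← hk, ← hl]
      rfl
    · rw [hP, ← hp.powPart_one, hmem a ha]
      rfl
    · rw [← hmem a ha, powPart_zero]
      rfl
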